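/- Let $G$ be a connected compact (real, finite-dimensional) semisimple Lie group with identity $e$ and Lie algebra $\mathfrak g=T_eG$, that is, $\mathfrak g$ is a semisimple Lie algebra. Let $\varphi=\{\varphi_t\}_{t\in\mathbb R}$ be a flow of automorphisms of $G$, i.e. a (smooth) one-parameter group of Lie group automorphisms: $\varphi_0=\mathrm{id}$, $\varphi_{s+t}=\varphi_s\circ\varphi_t$, each $\varphi_t$ is an automorphism of $G$, and $(t,g)\mapsto\varphi_t(g)$ is smooth. Then: 1. The negative Killing form $\langle X,Y\rangle=-\operatorname{tr}(\operatorname{ad}X\,\operatorname{ad}Y)$ is an inner product on $\mathfrak g$ which is invariant under $(d\varphi_t)_e$ for all $t\in\mathbb R$. 2. $\varphi$ is elliptic: there is a (necessarily unique) derivation $\mathcal D$ of $\mathfrak g$ with $(d\varphi_t)_e=\mathrm e^{t\mathcal D}$ for all $t\in\mathbb R$, and $\mathcal D$ is semisimple with all of its complex eigenvalues purely imaginary (possibly $0$). 3. $\varphi$ is chain transitive. Here, for a neighborhood $U$ of $e$ and $\tau>0$, a $(U,\tau)$-chain from $x$ to $y$ consists of $n\ge 1$, points $x_0=x,x_1,\dots,x_n=y$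 of $G$ and times $\tau_0,\dots,\tau_{n-1}\ge\tau$ with $x_{i+1}^{-1}\varphi_{\tau_i}(x_i)\in U$ for $0\le i<n$; $\Omega(x)$ is the set of all $y$ such that for every $U$ and $\tau$ there is a $(U,\tau)$-chain from $x$ to $y$; the chain recurrent set is $\{x : x\in\Omega(x)\}$; the chain transitive components are the classes in the chain recurrent set of the equivalence relation "$x\in\Omega(y)$ and $y\in\Omega(x)$"; and $\varphi$ is chain transitive if $G$ is contained in a chain transitive component. -/

import Mathlib

open scoped Manifold ContDiff Topology

noncomputable section

namespace AutomorphismFlow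

/-- A linear endomorphism of a real vector space is *elliptic* if it is semisimple and all of its
(complex) eigenvalues, i.e. the eigenvalues of its complexification, are purely imaginary
(the eigenvalue `0` is allowed). -/
def IsEllipticEnd {V : Type*} [AddCommGroup V] [Module ℝ V] (D : Module.End ℝ V) : Prop :=
  D.IsSemisimple ∧
    ∀ z : ℂ, Module.End.HasEigenvalue (LinearMap.baseChange ℂ D) z → z.re = 0

/-- The exponential of an endomorphism of a finite-dimensional real normed space. -/
def expEnd {E : Type*} [NormedAddCommGroup E] [NormedSpace ℝ E] [FiniteDimensional ℝ E]
    (A : E →ₗ[ℝ] E) : E →L[ℝ] E :=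
  NormedSpace.exp (LinearMap.toContinuousLinearMap A)

section LieGroup

variable {E : Type*} [NormedAddCommGroup E] [NormedSpace ℝ E]

/-- The smoothness class in which Mathlib defines the Lie algebra of a Lie group is implied by
smoothness. -/
instance lieGroup_minSmoothness (G : Type*) [TopologicalSpace G] [ChartedSpace E G] [Group G]
    [LieGroup 𝓘(ℝ, E) ∞ G] : LieGroup 𝓘(ℝ, E) (minSmoothness ℝ 3) G :=
  LieGroup.of_le (n := ∞) (by simpa using ENat.LEInfty.out)

variable (E) in
/-- The Lie algebra `𝔤 = T_e G` of a real Lie group `G` modelled on `E`. -/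
abbrev LieAlg (G : Type*) [TopologicalSpace G] [ChartedSpace E G] [Group G] : Type _ :=
  GroupLieAlgebra 𝓘(ℝ, E) G

variable (E) in
/-- A *flow of automorphisms* of a Lie group `G`: a (smooth) one-parameter group
`t ↦ φ_t` of automorphisms of the Lie group `G`. -/
structure Flow (G : Type*) [TopologicalSpace G] [ChartedSpace E G] [Group G] where
  /-- the automorphism `φ_t` -/
  toFun : ℝ → MulAut G
  map_zero' : toFun 0 = 1
  map_add' : ∀ s t : ℝ, toFun (s + t) = toFun s * toFun t
  smooth' : ContMDiff (𝓘(ℝ, ℝ).prod 𝓘(ℝ, E)) 𝓘(ℝ, E) ∞ (fun p : ℝ × G => toFun p.1 p.2)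

namespace Flow

variable {G : Type*} [TopologicalSpace G] [ChartedSpace E G] [Group G]

instance : CoeFun (Flow E G) (fun _ => ℝ → MulAut G) := ⟨Flow.toFun⟩

/-- The differential `(dφ_t)_e : T_e G → T_e G`. The automorphism `φ_t` fixes `e`, so that
the target `T_{φ_t e} G` of the manifold derivative at `e` is `T_e G`. -/
def diffAtOne (φ : Flow E G) (t : ℝ) : LieAlg E G →L[ℝ] LieAlg E G :=
  (mfderiv 𝓘(ℝ, E) 𝓘(ℝ, E) (fun g : G => φ t g) (1 : G) : E →L[ℝ] E)

/-- `D` is the derivation associated with the flow `φ`: `(dφ_t)_e = exp (t D)` for all `t`. -/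
def HasDerivation [FiniteDimensional ℝ E] [CompleteSpace E] [LieGroup 𝓘(ℝ, E) ∞ G]
    (φ : Flow E G) (D : LieDerivation ℝ (LieAlg E G) (LieAlg E G)) : Prop :=
  ∀ t : ℝ, φ.diffAtOne t = expEnd (E := E) (t • (D : LieAlg E G →ₗ[ℝ] LieAlg E G))

/-- A flow of automorphisms is *elliptic* if it has an associated derivation (necessarily
unique) and this derivation is elliptic. -/
def IsElliptic [FiniteDimensional ℝ E] [CompleteSpace E] [LieGroup 𝓘(ℝ, E) ∞ G]
    (φ : Flow E G) : Prop :=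
  ∃ D : LieDerivation ℝ (LieAlg E G) (LieAlg E G), φ.HasDerivation D ∧
    IsEllipticEnd (D : LieAlg E G →ₗ[ℝ] LieAlg E G)

/-- There is a `(U, τ)`-chain from `x` to `y`: points `x_0 = x, …, x_n = y` and times
`τ_0, …, τ_{n-1} ≥ τ`, with at least one jump (`n ≥ 1`), such that
`x_{i+1}⁻¹ φ_{τ_i}(x_i) ∈ U` for all `i < n`. (Values of the sequences at larger indices are
irrelevant.) -/
def ExistsChain (φ : Flow E G) (U : Set G) (τ : ℝ) (x y : G) : Prop :=
  ∃ (n : ℕ) (ξ : ℕ → G) (s : ℕ → ℝ), 1 ≤ n ∧ ξ 0 = x ∧ ξ n = y ∧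
    ∀ i < n, τ ≤ s i ∧ (ξ (i + 1))⁻¹ * φ (s i) (ξ i) ∈ U

/-- The chain limit set `Ω(x)`. -/
def chainLimitSet (φ : Flow E G) (x : G) : Set G :=
  {y | ∀ U ∈ 𝓝 (1 : G), ∀ τ : ℝ, 0 < τ → φ.ExistsChain U τ x y}

/-- The chain recurrent set of the flow. -/
def chainRecurrentSet (φ : Flow E G) : Set G :=
  {x | x ∈ φ.chainLimitSet x}

/-- The chain transitive components: the classes in the chain recurrent set of the relation
`x ∈ Ω(y)` and `y ∈ Ω(x)`. -/
def IsChainTransitiveComponent (φ : Flow E G) (C : Set G) : Prop :=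
  ∃ x ∈ φ.chainRecurrentSet,
    C = {y | y ∈ φ.chainRecurrentSet ∧ x ∈ φ.chainLimitSet y ∧ y ∈ φ.chainLimitSet x}

/-- A subset of `G` is chain transitive if it is contained in a chain transitive component. -/
def IsChainTransitiveSet (φ : Flow E G) (F : Set G) : Prop :=
  ∃ C, φ.IsChainTransitiveComponent C ∧ F ⊆ C

/-- The flow is chain transitive if `G` is a chain transitive subset. -/
def IsChainTransitive (φ : Flow E G) : Prop :=
  φ.IsChainTransitiveSet Set.univ

end Flow

end LieGroup

end AutomorphismFlow

end

/-! Compactness gives an inner product on the Lie algebra invariant under the adjoint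
representation, by averaging over Haar measure (`exists_invariant_posDef`). Since the derivative of
`Ad` at the identity is the bracket (`fderiv_Ad_chart_symm`), every `ad X` is skew for it, so tr((ad
X)²) = -∑ |ad X bᵢ|² < 0 unless X is central, and semisimplicity leaves no nonzero central X
(`killingForm_neg_of_compact`).

The differentials of the flow are Lie algebra automorphisms (`diffAtOne_lie`), hence preserve the
Killing form. They form a differentiable one-parameter group, so they are exponentials of a
derivation D. Differentiating the invariance makes D skew for the negative Killing form, and a skew
operator is elliptic (`isEllipticEnd_of_skew`).

Chain transitivity needs only compactness and connectedness. Automorphisms preserve Haar measure, so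
Poincaré recurrence applies and chains reach every point near their start
(`exists_nhds_transGen_jump`); the set reachable from a point is then clopen. -/

noncomputable section

namespace AutomorphismFlow

/-! ### Real and imaginary parts in the complexification -/

section ComplexEigenvalues

open scoped TensorProduct

variable {V : Type*} [AddCommGroup V] [Module ℝ V]

/-- The real part `ℂ ⊗ V → V`. -/
def tensorRe : ℂ ⊗[ℝ] V →ₗ[ℝ] V :=
  (TensorProduct.lid ℝ V).toLinearMap ∘ₗ LinearMap.rTensor V Complex.reLm

/-- The imaginary part `ℂ ⊗ V → V`. -/
def tensorIm : ℂ ⊗[ℝ] V →ₗ[ℝ] V :=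
  (TensorProduct.lid ℝ V).toLinearMap ∘ₗ LinearMap.rTensor V Complex.imLm

@[simp] lemma tensorRe_tmul (c : ℂ) (v : V) : tensorRe (c ⊗ₜ[ℝ] v) = c.re • v := by
  simp [tensorRe]

@[simp] lemma tensorIm_tmul (c : ℂ) (v : V) : tensorIm (c ⊗ₜ[ℝ] v) = c.im • v := by
  simp [tensorIm]

lemma tensorRe_smul (z : ℂ) (w : ℂ ⊗[ℝ] V) :
    tensorRe (z • w) = z.re • tensorRe w - z.im • tensorIm w := by
  induction w with
  | zero => simp
  | tmul c v => simp [TensorProduct.smul_tmul', sub_smul, mul_smul]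
  | add a b ha hb => simp only [smul_add, map_add, ha, hb]; abel

lemma tensorIm_smul (z : ℂ) (w : ℂ ⊗[ℝ] V) :
    tensorIm (z • w) = z.re • tensorIm w + z.im • tensorRe w := by
  induction w with
  | zero => simp
  | tmul c v => simp [TensorProduct.smul_tmul', add_smul, mul_smul]
  | add a b ha hb => simp only [smul_add, map_add, ha, hb]; abel

lemma tensorRe_baseChange (D : Module.End ℝ V) (w : ℂ ⊗[ℝ] V) :
    tensorRe (LinearMap.baseChange ℂ D w) = D (tensorRe w) := by
  induction w with
  | zero => simp
  | tmul c v => simp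
  | add a b ha hb => simp only [map_add, ha, hb]

lemma tensorIm_baseChange (D : Module.End ℝ V) (w : ℂ ⊗[ℝ] V) :
    tensorIm (LinearMap.baseChange ℂ D w) = D (tensorIm w) := by
  induction w with
  | zero => simp
  | tmul c v => simp
  | add a b ha hb => simp only [map_add, ha, hb]

/-- Guarantees that an eigenvector has a nonzero real or imaginary part. -/
lemma tmul_tensorRe_add_tmul_tensorIm (w : ℂ ⊗[ℝ] V) :
    (1 : ℂ) ⊗ₜ[ℝ] tensorRe w + Complex.I ⊗ₜ[ℝ] tensorIm w = w := by
  induction w with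
  | zero => simp
  | tmul c v =>
    simp only [tensorRe_tmul, tensorIm_tmul, TensorProduct.tmul_smul, TensorProduct.smul_tmul',
      ← TensorProduct.add_tmul]
    congr 1
    apply Complex.ext <;> simp
  | add a b ha hb =>
    conv_rhs => rw [← ha, ← hb]
    simp only [map_add, TensorProduct.tmul_add]; abel

end ComplexEigenvalues

/-! ### Operators skew for a positive definite form -/

section PosDef

variable {V : Type*} [AddCommGroup V] [Module ℝ V]

/-- The inner product given by a symmetric positive definite bilinear form. -/
abbrev innerCoreOfPosDef (B : V →ₗ[ℝ] V →ₗ[ℝ] ℝ) (hsymm : ∀ x y, B x y = B y x)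
    (hpos : ∀ x, x ≠ 0 → 0 < B x x) : InnerProductSpace.Core ℝ V where
  inner x y := B x y
  conj_inner_symm x y := by simp [hsymm y x]
  re_inner_nonneg x := by
    rcases eq_or_ne x 0 with rfl | h
    · simp
    · simpa using (hpos x h).le
  definite x h := by
    by_contra hx
    exact (hpos x hx).ne' h
  add_left x y z := by simp
  smul_left x y r := by simp

/-- An endomorphism that is skew for a positive definite form is elliptic. -/
theorem isEllipticEnd_of_skew [FiniteDimensional ℝ V] (B : V →ₗ[ℝ] V →ₗ[ℝ] ℝ)
    (hsymm : ∀ x y, B x y = B y x) (hpos : ∀ x, x ≠ 0 → 0 < B x x) (D : Module.End ℝ V)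
    (hD : ∀ x y, B (D x) y + B x (D y) = 0) : IsEllipticEnd D := by
  refine ⟨?_, fun z hz => ?_⟩
  · rw [Module.End.isSemisimple_iff]
    intro p hp
    let _ : NormedAddCommGroup V := (innerCoreOfPosDef B hsymm hpos).toNormedAddCommGroup
    let _ : InnerProductSpace ℝ V := .ofCore (innerCoreOfPosDef B hsymm hpos).toCore
    have hB : ∀ x y : V, inner ℝ x y = B x y := fun _ _ => rfl
    -- Skewness makes the orthogonal complement of an invariant subspace invariant.
    refine ⟨pᗮ, fun x hx => ?_, p.isCompl_orthogonal⟩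
    rw [Submodule.mem_comap, Submodule.mem_orthogonal]
    rw [Submodule.mem_orthogonal] at hx
    intro u hu
    have h1 := hx (D u) (hp hu)
    rw [hB] at h1 ⊢
    linarith [hD u x]
  · obtain ⟨w, hw, hw0⟩ := hz.exists_hasEigenvector
    rw [Module.End.mem_eigenspace_iff] at hw
    have h1 := congrArg tensorRe hw
    have h2 := congrArg tensorIm hw
    rw [tensorRe_baseChange, tensorRe_smul] at h1
    rw [tensorIm_baseChange, tensorIm_smul] at h2
    set a := tensorRe w
    set b := tensorIm w
    have ha := hD a a
    have hb := hD b b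
    rw [hsymm a (D a), h1] at ha
    rw [hsymm b (D b), h2] at hb
    simp only [map_sub, map_add, map_smul, LinearMap.sub_apply, LinearMap.add_apply,
      LinearMap.smul_apply, smul_eq_mul, hsymm b a] at ha hb
    -- For w = a + ib, the terms in `z.im` cancel in B(Da, a) + B(Db, b), which vanishes by
    -- skewness.
    have key : z.re * (B a a + B b b) = 0 := by linarith
    rcases mul_eq_zero.1 key with h | h
    · exact h
    · exfalso
      have hnn : ∀ x, 0 ≤ B x x := fun x => by
        rcases eq_or_ne x 0 with rfl | hx
        · simp
        · exact (hpos x hx).le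
      have ha0 : a = 0 := by
        by_contra h0
        linarith [hpos a h0, hnn b]
      have hb0 : b = 0 := by
        by_contra h0
        linarith [hpos b h0, hnn a]
      apply hw0
      rw [← tmul_tensorRe_add_tmul_tensorIm w]
      change (1 : ℂ) ⊗ₜ[ℝ] a + Complex.I ⊗ₜ[ℝ] b = 0
      simp [ha0, hb0]

/-- The trace of the square of a nonzero endomorphism that is skew for a positive definite form
is negative. -/
theorem trace_comp_self_neg_of_skew [FiniteDimensional ℝ V] (B : V →ₗ[ℝ] V →ₗ[ℝ] ℝ)
    (hsymm : ∀ x y, B x y = B y x) (hpos : ∀ x, x ≠ 0 → 0 < B x x) (A : Module.End ℝ V)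
    (hA : ∀ x y, B (A x) y + B x (A y) = 0) (hA0 : A ≠ 0) :
    LinearMap.trace ℝ V (A ∘ₗ A) < 0 := by
  let _ : NormedAddCommGroup V := (innerCoreOfPosDef B hsymm hpos).toNormedAddCommGroup
  let _ : InnerProductSpace ℝ V := .ofCore (innerCoreOfPosDef B hsymm hpos).toCore
  have hB : ∀ x y : V, inner ℝ x y = B x y := fun _ _ => rfl
  have hnn : ∀ x, 0 ≤ B x x := fun x => by
    rcases eq_or_ne x 0 with rfl | hx
    · simp
    · exact (hpos x hx).le
  let b := stdOrthonormalBasis ℝ V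
  rw [LinearMap.trace_eq_sum_inner _ b]
  have h1 : ∀ i, inner ℝ (b i) ((A ∘ₗ A) (b i)) = -B (A (b i)) (A (b i)) := fun i => by
    rw [hB, LinearMap.comp_apply]
    linarith [hA (b i) (A (b i))]
  simp only [h1]
  obtain ⟨i, hi⟩ : ∃ i, A (b i) ≠ 0 := by
    by_contra! h
    exact hA0 (b.toBasis.ext fun i => by simpa using h i)
  exact Finset.sum_neg' (fun i _ => by linarith [hnn (A (b i))])
    ⟨i, Finset.mem_univ i, by linarith [hpos _ hi]⟩

/-- A Lie algebra with trivial center and an invariant inner product has negative definite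
Killing form. -/
theorem killingForm_neg_of_invariant {L : Type*} [LieRing L] [LieAlgebra ℝ L]
    [FiniteDimensional ℝ L] (hcenter : LieAlgebra.center ℝ L = ⊥) (B : L →ₗ[ℝ] L →ₗ[ℝ] ℝ)
    (hsymm : ∀ x y, B x y = B y x) (hpos : ∀ x, x ≠ 0 → 0 < B x x)
    (hinv : ∀ x y z : L, B ⁅x, y⁆ z + B y ⁅x, z⁆ = 0) (X : L) (hX : X ≠ 0) :
    killingForm ℝ L X X < 0 := by
  rw [killingForm_apply_apply]
  refine trace_comp_self_neg_of_skew B hsymm hpos (LieAlgebra.ad ℝ L X) (hinv X) fun h => hX ?_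
  have hmem : X ∈ LieAlgebra.center ℝ L := by
    rw [LieModule.mem_maxTrivSubmodule]
    intro y
    have : ⁅X, y⁆ = 0 := by simpa using LinearMap.congr_fun h y
    rw [← lie_skew, this, neg_zero]
  simpa [hcenter] using hmem

end PosDef

/-! ### Recurrence and chain transitivity -/

section ChainTransitivity

open Set MeasureTheory

variable {E : Type*} [NormedAddCommGroup E] [NormedSpace ℝ E]
  {G : Type*} [TopologicalSpace G] [ChartedSpace E G] [Group G]

namespace Flow

lemma apply_add (φ : Flow E G) (s t : ℝ) (g : G) : φ (s + t) g = φ s (φ t g) := by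
  rw [φ.map_add']; rfl

lemma apply_zero (φ : Flow E G) (g : G) : φ 0 g = g := by
  rw [φ.map_zero']; rfl

lemma contMDiff_apply (φ : Flow E G) (t : ℝ) :
    ContMDiff 𝓘(ℝ, E) 𝓘(ℝ, E) ∞ (fun g : G => φ t g) :=
  φ.smooth'.comp (contMDiff_const.prodMk contMDiff_id)

lemma continuous_apply (φ : Flow E G) (t : ℝ) : Continuous (φ t) :=
  (φ.contMDiff_apply t).continuous

/-- A single jump of a `(U, τ)`-chain. -/
def Jump (φ : Flow E G) (U : Set G) (τ : ℝ) (x y : G) : Prop :=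
  ∃ s : ℝ, τ ≤ s ∧ y⁻¹ * φ s x ∈ U

/-- With chains encoded as a transitive closure, concatenation is plain transitivity. -/
lemma existsChain_of_transGen (φ : Flow E G) {U : Set G} {τ : ℝ} {x y : G}
    (h : Relation.TransGen (φ.Jump U τ) x y) : φ.ExistsChain U τ x y := by
  induction h with
  | @single y h =>
    obtain ⟨s, hs, hU⟩ := h
    refine ⟨1, fun i => if i = 0 then x else y, fun _ => s, le_rfl, by simp, by simp, ?_⟩
    intro i hi
    obtain rfl : i = 0 := by omega
    simpa using ⟨hs, hU⟩
  | @tail y z _ h ih =>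
    obtain ⟨s, hs, hU⟩ := h
    obtain ⟨n, ξ, σ, hn, h0, hlast, hstep⟩ := ih
    refine ⟨n + 1, fun i => if i ≤ n then ξ i else z, fun i => if i < n then σ i else s,
      by omega, by simpa using h0, by simp, ?_⟩
    intro i hi
    rcases Nat.lt_or_ge i n with h | h
    · simpa [h, h.le, Nat.succ_le_iff.2 h] using hstep i h
    · obtain rfl : i = n := by omega
      simpa [hlast] using ⟨hs, hU⟩

lemma apply_iterate (φ : Flow E G) (τ : ℝ) (n : ℕ) (g : G) :
    (φ τ)^[n] g = φ (n * τ) g := by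
  induction n generalizing g with
  | zero => simp [φ.apply_zero]
  | succ n ih =>
    rw [Function.iterate_succ_apply, ih, ← φ.apply_add]
    congr 2
    push_cast; ring

/-- Poincaré recurrence for the Haar measure: every nonempty open set has arbitrarily late
returns. -/
lemma exists_recurrence [IsTopologicalGroup G] [CompactSpace G] (φ : Flow E G) (τ : ℝ)
    {V : Set G} (hV : IsOpen V) (hne : V.Nonempty) :
    ∃ v ∈ V, ∃ n : ℕ, n ≠ 0 ∧ φ (n * τ) v ∈ V := by
  borelize G
  -- A continuous surjective endomorphism sends Haar measure to a Haar measure of the same finite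
  -- total mass, hence to itself.
  have hmp : MeasurePreserving (φ τ) (Measure.haar : Measure G) Measure.haar :=
    MonoidHom.measurePreserving (f := (φ τ).toMonoidHom) (φ.continuous_apply τ)
      (φ τ).surjective rfl
  obtain ⟨v, hv, n, hn, hvn⟩ := hmp.conservative.exists_mem_iterate_mem
    hV.measurableSet.nullMeasurableSet (hV.measure_ne_zero _ hne)
  exact ⟨v, hv, n, hn, by rwa [φ.apply_iterate] at hvn⟩

/-- Two jumps suffice. Choose a point v of xW that returns to xW. Jump from x to φ_τ(v), the error
being φ_τ(v⁻¹x); then follow the orbit of v until it returns to xW and jump to xw, the error lying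
in W⁻¹W. -/
lemma exists_nhds_transGen_jump [IsTopologicalGroup G] [CompactSpace G] (φ : Flow E G)
    {U : Set G} (hU : U ∈ 𝓝 (1 : G)) {τ : ℝ} (hτ : 0 < τ) :
    ∃ W ∈ 𝓝 (1 : G), ∀ x, ∀ w ∈ W, Relation.TransGen (φ.Jump U τ) x (x * w) := by
  have hpre : (φ τ) ⁻¹' U ∈ 𝓝 (1 : G) := by
    apply (φ.continuous_apply τ).continuousAt.preimage_mem_nhds
    simpa using hU
  have hdiv : Filter.Tendsto (fun p : G × G => p.1⁻¹ * p.2) (𝓝 (1, 1)) (𝓝 1) := by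
    have : Continuous (fun p : G × G => p.1⁻¹ * p.2) := by fun_prop
    simpa using this.tendsto (1, 1)
  obtain ⟨W, hWo, hW1, hWsub⟩ : ∃ W : Set G, IsOpen W ∧ (1 : G) ∈ W ∧
      W ×ˢ W ⊆ (fun p : G × G => p.1⁻¹ * p.2) ⁻¹' (U ∩ (φ τ) ⁻¹' U) := by
    have := hdiv (Filter.inter_mem hU hpre)
    rw [Filter.mem_map, mem_nhds_prod_iff'] at this
    obtain ⟨A, B, hA, hA1, hB, hB1, hAB⟩ := this
    exact ⟨A ∩ B, hA.inter hB, ⟨hA1, hB1⟩,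
      (Set.prod_mono inter_subset_left inter_subset_right).trans hAB⟩
  refine ⟨W, hWo.mem_nhds hW1, fun x w hw => ?_⟩
  have hVo : IsOpen ((fun g => x⁻¹ * g) ⁻¹' W) := hWo.preimage (by fun_prop)
  -- Returns at multiples of 2τ leave time 2nτ - τ ≥ τ for the second jump.
  obtain ⟨v, hv, n, hn, hvn⟩ := φ.exists_recurrence (2 * τ) hVo ⟨x, by simpa using hW1⟩
  have hn1 : (1 : ℝ) ≤ n := by exact_mod_cast Nat.one_le_iff_ne_zero.2 hn
  refine .tail (.single (b := φ τ v) ⟨τ, le_rfl, ?_⟩) ⟨n * (2 * τ) - τ, by nlinarith, ?_⟩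
  · have := (hWsub (Set.mk_mem_prod hv hW1)).2
    simpa [mul_comm] using this
  · have := (hWsub (Set.mk_mem_prod hw hvn)).1
    rw [← φ.apply_add, sub_add_cancel]
    simpa [mul_assoc] using this

/-- A flow of automorphisms of a compact connected group is chain transitive. -/
theorem isChainTransitive_of_compact [IsTopologicalGroup G] [CompactSpace G] [ConnectedSpace G]
    (φ : Flow E G) : φ.IsChainTransitive := by
  have key : ∀ x y : G, y ∈ φ.chainLimitSet x := by
    intro x y U hU τ hτ
    apply φ.existsChain_of_transGen
    obtain ⟨W, hW, hchain⟩ := φ.exists_nhds_transGen_jump hU hτ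
    let R : Set G := {y | Relation.TransGen (φ.Jump U τ) x y}
    have hmul : ∀ z ∈ R, ∀ w ∈ W, z * w ∈ R := fun z hz w hw =>
      Relation.TransGen.trans hz (hchain z w hw)
    have hopen : IsOpen R := by
      rw [isOpen_iff_mem_nhds]
      intro z hz
      have : (fun g => z⁻¹ * g) ⁻¹' W ∈ 𝓝 z := by
        apply ContinuousAt.preimage_mem_nhds (by fun_prop)
        simpa using hW
      filter_upwards [this] with g hg
      simpa using hmul z hz _ hg
    -- If g in R is close to z, then z = g(g⁻¹z) is reachable too.
    have hclosed : IsClosed R := by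
      rw [← isOpen_compl_iff, isOpen_iff_mem_nhds]
      intro z hz
      have : (fun g => g⁻¹ * z) ⁻¹' W ∈ 𝓝 z := by
        apply ContinuousAt.preimage_mem_nhds (by fun_prop)
        simpa using hW
      filter_upwards [this] with g hg hgR
      exact hz (by simpa using hmul g hgR _ hg)
    have hne : R.Nonempty := ⟨x * 1, hchain x 1 (mem_of_mem_nhds hW)⟩
    have huniv : R = univ := IsClopen.eq_univ ⟨hclosed, hopen⟩ hne
    have : y ∈ R := huniv ▸ mem_univ y
    exact this
  exact ⟨univ, ⟨1, key 1 1, by ext y; simp [key, chainRecurrentSet]⟩, subset_rfl⟩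

end Flow

end ChainTransitivity

/-! ### Second derivatives of a local group law; one-parameter groups -/

section Calculus

open Filter

variable {E : Type*} [NormedAddCommGroup E] [NormedSpace ℝ E]

/-- Let `m` be a local multiplication on a vector space with unit `a`, and let `k` be the
conjugation `k(x, y) = x y x⁻¹`. Then the derivative at `a` of `x ↦ ∂₂k(x, a) Y` in the direction
`X` is the Lie bracket at `a` of the left invariant vector fields `∂₂m(·, a) X` and
`∂₂m(·, a) Y`. -/
theorem fderiv_conj_apply_eq_lieBracket {m k : E × E → E} {a : E}
    (hm : ContDiffAt ℝ 2 m (a, a))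
    (hkx : ∀ᶠ x in 𝓝 a, DifferentiableAt ℝ (fun y => k (x, y)) a)
    (hK : DifferentiableAt ℝ (fun x => fderiv ℝ (fun y => k (x, y)) a) a)
    (hm1 : ∀ᶠ x in 𝓝 a, m (x, a) = x) (hm2 : ∀ᶠ y in 𝓝 a, m (a, y) = y)
    (hk1 : ∀ᶠ x in 𝓝 a, k (x, a) = a) (hk2 : ∀ᶠ y in 𝓝 a, k (a, y) = y)
    (hmk : ∀ᶠ p in 𝓝 (a, a), m p = m (k p, p.1)) (X Y : E) :
    fderiv ℝ (fun x => fderiv ℝ (fun y => k (x, y)) a) a X Y =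
      VectorField.lieBracket ℝ (fun x => fderiv ℝ (fun y => m (x, y)) a X)
        (fun x => fderiv ℝ (fun y => m (x, y)) a Y) a := by
  set K : E → E →L[ℝ] E := fun x => fderiv ℝ (fun y => k (x, y)) a with hKdef
  set F : E × E → E × E →L[ℝ] E := fderiv ℝ m with hF
  set M := fderiv ℝ F (a, a) with hM
  have hFd : HasFDerivAt F M (a, a) :=
    ((hm.fderiv_right (m := 1) (by norm_num)).differentiableAt (by norm_num)).hasFDerivAt
  have hsymm : ∀ v w, M v w = M w v := by
    have := hm.isSymmSndFDerivAt (by simp)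
    exact this
  have hmd : ∀ᶠ p in 𝓝 (a, a), DifferentiableAt ℝ m p :=
    (hm.eventually (by simp)).mono fun p hp => hp.differentiableAt (by norm_num)
  have hl : Tendsto (fun x : E => (x, a)) (𝓝 a) (𝓝 (a, a)) := by
    have : Continuous (fun x : E => (x, a)) := by fun_prop
    exact this.tendsto a
  have hr : Tendsto (fun x : E => (a, x)) (𝓝 a) (𝓝 (a, a)) := by
    have : Continuous (fun x : E => (a, x)) := by fun_prop
    exact this.tendsto a
  -- the left invariant vector fields and their derivatives at `a`
  have hfield : ∀ Z, (fun x => fderiv ℝ (fun y => m (x, y)) a Z) =ᶠ[𝓝 a]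
      fun x => F (x, a) (0, Z) := by
    intro Z
    filter_upwards [hl.eventually hmd] with x hx
    have h1 : HasFDerivAt (fun y : E => (x, y)) (ContinuousLinearMap.inr ℝ E E) a :=
      hasFDerivAt_prodMk_right x a
    have := (hx.hasFDerivAt.comp a h1).fderiv
    change fderiv ℝ (m ∘ fun y => (x, y)) a Z = _
    rw [this]
    simp [hF]
  have hfield' : ∀ Z, HasFDerivAt (fun x => F (x, a) (0, Z))
      ((M.comp (ContinuousLinearMap.inl ℝ E E)).flip (0, Z)) a := by
    intro Z
    have h1 : HasFDerivAt (fun x : E => (x, a)) (ContinuousLinearMap.inl ℝ E E) a :=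
      hasFDerivAt_prodMk_left a a
    have h2 := (HasFDerivAt.comp (f := fun x : E => (x, a)) a hFd h1).clm_apply
      (hasFDerivAt_const ((0 : E), Z) a)
    refine h2.congr_fderiv ?_
    ext v
    simp
  have hFl : ∀ v, F (a, a) (v, 0) = v := by
    intro v
    have h1 := (HasFDerivAt.comp (f := fun x : E => (x, a)) a hmd.self_of_nhds.hasFDerivAt
      (hasFDerivAt_prodMk_left a a)).fderiv
    have h2 : (m ∘ fun x => (x, a)) =ᶠ[𝓝 a] id := hm1
    rw [h2.fderiv_eq, fderiv_id] at h1
    simpa [hF] using (DFunLike.congr_fun h1 v).symm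
  have hFr : ∀ v, F (a, a) (0, v) = v := by
    intro v
    have h1 := (hmd.self_of_nhds.hasFDerivAt.comp a (hasFDerivAt_prodMk_right a a)).fderiv
    have h2 : (m ∘ fun x => (a, x)) =ᶠ[𝓝 a] id := hm2
    rw [h2.fderiv_eq, fderiv_id] at h1
    simpa [hF] using (DFunLike.congr_fun h1 v).symm
  have hKa : K a = ContinuousLinearMap.id ℝ E := by
    have h2 : (fun y => k (a, y)) =ᶠ[𝓝 a] id := hk2
    simp only [hKdef]
    rw [h2.fderiv_eq, fderiv_id]
  -- differentiating `m(x, y) = m(k(x, y), x)` in `y`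
  have hmain : (fun x => F (x, a) (0, Y)) =ᶠ[𝓝 a] fun x => F (a, x) (K x Y, 0) := by
    filter_upwards [hfield Y, hr.eventually hmd, hk1, hl.eventually hmk.eventually_nhds, hkx]
      with x h1 h2 h3 h4 h5
    rw [← h1]
    have h6 : (fun y => m (x, y)) =ᶠ[𝓝 a] fun y => m (k (x, y), x) := by
      have : Tendsto (fun y : E => (x, y)) (𝓝 a) (𝓝 (x, a)) := by
        have : Continuous (fun y : E => (x, y)) := by fun_prop
        exact this.tendsto a
      exact this.eventually h4
    rw [h6.fderiv_eq]
    have h7 : HasFDerivAt (fun y => (k (x, y), x)) ((K x).prod 0) a :=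
      h5.hasFDerivAt.prodMk (hasFDerivAt_const x a)
    have h8 : HasFDerivAt m (F (a, x)) (k (x, a), x) := by
      rw [h3]; exact h2.hasFDerivAt
    have := (h8.comp a h7).fderiv
    change fderiv ℝ (m ∘ fun y => (k (x, y), x)) a Y = _
    rw [this]
    simp
  have hright : HasFDerivAt (fun x => F (a, x) (K x Y, 0))
      ((M.comp (ContinuousLinearMap.inr ℝ E E)).flip (Y, 0) + (fderiv ℝ K a).flip Y) a := by
    have h1 : HasFDerivAt (fun x : E => (a, x)) (ContinuousLinearMap.inr ℝ E E) a :=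
      hasFDerivAt_prodMk_right a a
    have h2 : HasFDerivAt (fun x => K x Y) ((fderiv ℝ K a).flip Y) a := by
      refine (hK.hasFDerivAt.clm_apply (hasFDerivAt_const Y a)).congr_fderiv ?_
      ext v; simp
    have h3 := (HasFDerivAt.comp a hFd h1).clm_apply (h2.prodMk (hasFDerivAt_const (0 : E) a))
    refine h3.congr_fderiv ?_
    ext v
    simp [hKa, hFl]
    abel
  -- This reads M(X,0)(0,Y) = M(0,X)(Y,0) + K'(a)(X)(Y). Symmetry of the second derivative M turns
  -- the middle term into M(Y,0)(0,X), so K'(a)(X)(Y) is the bracket.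
  have heq := congrArg (fun L => L X) ((hfield' Y).congr_of_eventuallyEq hmain.symm |>.unique hright)
  have hb : VectorField.lieBracket ℝ (fun x => fderiv ℝ (fun y => m (x, y)) a X)
        (fun x => fderiv ℝ (fun y => m (x, y)) a Y) a = M (X, 0) (0, Y) - M (Y, 0) (0, X) := by
    rw [VectorField.lieBracket, (hfield X).fderiv_eq, (hfield Y).fderiv_eq, (hfield' X).fderiv,
      (hfield' Y).fderiv]
    have hXa := (hfield X).self_of_nhds
    have hYa := (hfield Y).self_of_nhds
    simp only [hFr] at hXa hYa
    simp only [hXa, hYa]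
    simp
  rw [hb]
  simp at heq
  rw [heq, hsymm (0, X)]
  abel

/-- A differentiable one-parameter group of operators is the exponential of its generator. -/
theorem eq_exp_of_oneParameterGroup [CompleteSpace E] {T : ℝ → E →L[ℝ] E}
    (h0 : T 0 = 1) (hadd : ∀ s t, T (s + t) = T s * T t)
    {D : E →L[ℝ] E} (hD : HasDerivAt T D 0) (t : ℝ) : T t = NormedSpace.exp (t • D) := by
  have hT : ∀ t, HasDerivAt T (T t * D) t := by
    intro t
    have h1 : HasDerivAt (fun s => T (s - t)) D t := by
      have := HasDerivAt.comp_sub_const (f := T) (f' := D) t t (by simpa using hD)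
      exact this
    have h2 := h1.const_mul (T t)
    refine h2.congr_of_eventuallyEq (Eventually.of_forall fun s => ?_)
    change T s = T t * T (s - t)
    rw [← hadd]; congr 1; ring
  -- T(t) exp(-tD) is constant, hence equal to its value 1 at t = 0.
  have hconst : ∀ s, HasDerivAt (fun t : ℝ => T t * NormedSpace.exp (t • (-D))) 0 s := by
    intro s
    refine ((hT s).mul (hasDerivAt_exp_smul_const' (-D) s)).congr_deriv ?_
    simp [mul_assoc]
  have h1 := is_const_of_deriv_eq_zero (fun s => (hconst s).differentiableAt)
    (fun s => (hconst s).deriv) t 0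
  simp only [zero_smul, NormedSpace.exp_zero, mul_one, h0] at h1
  let _ : NormedAlgebra ℚ (E →L[ℝ] E) := NormedAlgebra.restrictScalars ℚ ℝ _
  have h2 : NormedSpace.exp (t • (-D)) * NormedSpace.exp (t • D) = 1 := by
    rw [← NormedSpace.exp_add_of_commute]
    · simp
    · exact ((Commute.refl D).neg_left.smul_left t).smul_right t
  calc T t = T t * (NormedSpace.exp (t • (-D)) * NormedSpace.exp (t • D)) := by rw [h2, mul_one]
    _ = _ := by rw [← mul_assoc, h1, one_mul]

end Calculus

/-! ### Averaging an inner product over a compact group -/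

section Averaging

open MeasureTheory

variable {E : Type*} [NormedAddCommGroup E] [NormedSpace ℝ E] [FiniteDimensional ℝ E]

/-- Leibniz rule for a bilinear map on finite-dimensional spaces. -/
lemma hasDerivAt_bilinear {F : Type*} [NormedAddCommGroup F] [NormedSpace ℝ F]
    (B : E →ₗ[ℝ] E →ₗ[ℝ] F) {u v : ℝ → E} {u' v' : E} {t : ℝ}
    (hu : HasDerivAt u u' t) (hv : HasDerivAt v v' t) :
    HasDerivAt (fun s => B (u s) (v s)) (B u' (v t) + B (u t) v') t := by
  let C : E →L[ℝ] E →L[ℝ] F :=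
    LinearMap.toContinuousLinearMap (LinearMap.toContinuousLinearMap.toLinearMap ∘ₗ B)
  have h := (C.hasFDerivAt.comp_hasDerivAt t hu).clm_apply hv
  exact h

/-- A continuous representation of a compact group on a finite-dimensional real vector space
preserves an inner product. -/
theorem exists_invariant_posDef {G : Type*} [TopologicalSpace G] [Group G] [IsTopologicalGroup G]
    [CompactSpace G] (A : G → E →L[ℝ] E) (hA : Continuous A) (h1 : A 1 = 1)
    (hmul : ∀ g h, A (g * h) = A g * A h) :
    ∃ B : E →ₗ[ℝ] E →ₗ[ℝ] ℝ, (∀ x y, B x y = B y x) ∧ (∀ x, x ≠ 0 → 0 < B x x) ∧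
      ∀ g x y, B (A g x) (A g y) = B x y := by
  borelize G
  let b := Module.finBasis ℝ E
  let β : E → E → ℝ := fun x y => ∑ i, b.coord i x * b.coord i y
  have hcoord : ∀ i, Continuous (b.coord i) := fun i => (b.coord i).continuous_of_finiteDimensional
  -- With the inverse, replacing x, y by A(h)x, A(h)y amounts to replacing g by h⁻¹g, so left
  -- invariance of Haar measure applies.
  let f : E → E → G → ℝ := fun x y g => β (A g⁻¹ x) (A g⁻¹ y)
  have hf : ∀ x y, Continuous (f x y) := by
    intro x y
    have hx : ∀ x, Continuous (fun g => A g⁻¹ x) := fun x =>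
      (hA.comp continuous_inv).clm_apply continuous_const
    exact continuous_finsetSum _ fun i _ =>
      ((hcoord i).comp (hx x)).mul ((hcoord i).comp (hx y))
  have hint : ∀ x y, Integrable (f x y) (Measure.haar : Measure G) := fun x y =>
    (hf x y).integrable_of_hasCompactSupport (HasCompactSupport.of_compactSpace _)
  have hβ : ∀ x y, β x y = β y x := fun x y => by simp only [β, mul_comm]
  let B : E →ₗ[ℝ] E →ₗ[ℝ] ℝ := LinearMap.mk₂ ℝ (fun x y => ∫ g, f x y g ∂Measure.haar)
    (fun x x' y => by
      rw [← integral_add (hint _ _) (hint _ _)]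
      congr 1; ext g; simp [f, β, add_mul, Finset.sum_add_distrib])
    (fun c x y => by
      rw [smul_eq_mul, ← integral_const_mul]
      congr 1; ext g; simp [f, β, mul_assoc, Finset.mul_sum])
    (fun x y y' => by
      rw [← integral_add (hint _ _) (hint _ _)]
      congr 1; ext g; simp [f, β, mul_add, Finset.sum_add_distrib])
    (fun c x y => by
      rw [smul_eq_mul, ← integral_const_mul]
      congr 1; ext g; simp [f, β, mul_left_comm, Finset.mul_sum])
  have hB : ∀ x y, B x y = ∫ g, f x y g ∂Measure.haar := fun _ _ => rfl
  refine ⟨B, fun x y => ?_, fun x hx => ?_, fun h x y => ?_⟩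
  · rw [hB, hB]
    congr 1; ext g; exact hβ _ _
  · rw [hB]
    refine (hf x x).integral_pos_of_hasCompactSupport_nonneg_nonzero
      (HasCompactSupport.of_compactSpace _)
      (fun g => Finset.sum_nonneg fun i _ => mul_self_nonneg _) (x := 1) fun h0 => hx ?_
    apply b.ext_elem
    intro i
    have h2 : β x x = 0 := by simpa [f, h1] using h0
    have h3 := (Finset.sum_eq_zero_iff_of_nonneg fun i _ => mul_self_nonneg _).1 h2 i
      (Finset.mem_univ i)
    simpa using h3
  · rw [hB, hB, ← integral_mul_left_eq_self (f x y) h⁻¹]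
    congr 1; ext g
    simp [f, hmul]

end Averaging

/-! ### Differentials at a fixed point -/

section Manifold

variable {E : Type*} [NormedAddCommGroup E] [NormedSpace ℝ E]
  {G : Type*} [TopologicalSpace G] [ChartedSpace E G]

/-- Over a single base point the tangent coordinate changes are identities, so smoothness in tangent
coordinates is smoothness of the operator family itself. -/
lemma inTangentCoordinates_const {N : Type*} [IsManifold 𝓘(ℝ, E) 1 G] (p : G) (g : N → G)
    (hg : ∀ n, g n = p) (ϕ : N → E →L[ℝ] E) (x₀ : N) :
    inTangentCoordinates 𝓘(ℝ, E) 𝓘(ℝ, E) (fun _ => p) g ϕ x₀ = ϕ := by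
  obtain rfl : g = fun _ => p := funext hg
  funext x
  rw [inTangentCoordinates_eq _ _ _ (mem_chart_source E p) (mem_chart_source E p)]
  ext v
  simp only [ContinuousLinearMap.comp_apply]
  rw [(tangentBundleCore 𝓘(ℝ, E) G).coordChange_self _ _ (mem_chart_source E p),
    (tangentBundleCore 𝓘(ℝ, E) G).coordChange_self _ _ (mem_chart_source E p)]

/-- The manifold derivative at `p` of a self-map of a manifold modelled on `E`, as an operator
on the model space. -/
def modelDeriv (f : G → G) (p : G) : E →L[ℝ] E := mfderiv 𝓘(ℝ, E) 𝓘(ℝ, E) f p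

lemma modelDeriv_id (p : G) : modelDeriv (E := E) (id : G → G) p = 1 :=
  mfderiv_id

lemma modelDeriv_comp {f g : G → G} {p : G}
    (hf : MDifferentiableAt 𝓘(ℝ, E) 𝓘(ℝ, E) f (g p))
    (hg : MDifferentiableAt 𝓘(ℝ, E) 𝓘(ℝ, E) g p) :
    modelDeriv (E := E) (f ∘ g) p = modelDeriv f (g p) * modelDeriv g p :=
  mfderiv_comp (I' := 𝓘(ℝ, E)) p hf hg

/-- The differential at a common fixed point of a smooth family of maps depends smoothly on the
parameter. -/
lemma contMDiff_modelDeriv_of_fixed {E' : Type*} [NormedAddCommGroup E'] [NormedSpace ℝ E']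
    {N : Type*} [TopologicalSpace N] [ChartedSpace E' N] [IsManifold 𝓘(ℝ, E') ∞ N]
    [IsManifold 𝓘(ℝ, E) ∞ G] (p : G)
    (f : N → G → G) (hf : ContMDiff (𝓘(ℝ, E').prod 𝓘(ℝ, E)) 𝓘(ℝ, E) ∞ (Function.uncurry f))
    (hp : ∀ n, f n p = p) :
    ContMDiff 𝓘(ℝ, E') 𝓘(ℝ, E →L[ℝ] E) ∞ (fun n => modelDeriv (E := E) (f n) p) := by
  intro n
  have h := ContMDiffAt.mfderiv (m := ∞) (n := ∞) (x₀ := n) f (fun _ => p) (hf (n, p))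
    contMDiffAt_const (by simp)
  rw [← inTangentCoordinates_const p (fun x => f x p) hp (fun n => modelDeriv (E := E) (f n) p) n]
  exact h

lemma modelDeriv_eq_fderiv_chart {p : G} {f : G → G} (hp : f p = p)
    (hf : MDifferentiableAt 𝓘(ℝ, E) 𝓘(ℝ, E) f p) :
    modelDeriv (E := E) f p =
      fderiv ℝ (fun y => extChartAt 𝓘(ℝ, E) p (f ((extChartAt 𝓘(ℝ, E) p).symm y)))
        (extChartAt 𝓘(ℝ, E) p p) := by
  have h : modelDeriv (E := E) f p =
      fderivWithin ℝ (writtenInExtChartAt 𝓘(ℝ, E) 𝓘(ℝ, E) p f) (Set.range 𝓘(ℝ, E))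
        (extChartAt 𝓘(ℝ, E) p p) := hf.mfderiv
  rw [h]
  simp only [writtenInExtChartAt, hp, modelWithCornersSelf_coe, Set.range_id, fderivWithin_univ]
  rfl

end Manifold

/-! ### The adjoint representation -/

section Adjoint

variable {E : Type*} [NormedAddCommGroup E] [NormedSpace ℝ E]
  {G : Type*} [TopologicalSpace G] [ChartedSpace E G] [Group G]

variable (E) in
/-- The adjoint representation of a Lie group. -/
def Ad (g : G) : E →L[ℝ] E := modelDeriv (fun h : G => g * h * g⁻¹) (1 : G)

lemma Ad_one : Ad E (1 : G) = 1 := by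
  have : (fun h : G => 1 * h * 1⁻¹) = id := by ext; simp
  rw [Ad, this, modelDeriv_id]

variable [LieGroup 𝓘(ℝ, E) ∞ G]

lemma contMDiff_conj : ContMDiff (𝓘(ℝ, E).prod 𝓘(ℝ, E)) 𝓘(ℝ, E) ∞
    (fun p : G × G => p.1 * p.2 * p.1⁻¹) :=
  (contMDiff_fst.mul contMDiff_snd).mul contMDiff_fst.inv

lemma contMDiff_conj_right (g : G) : ContMDiff 𝓘(ℝ, E) 𝓘(ℝ, E) ∞ (fun h : G => g * h * g⁻¹) :=
  (contMDiff_const.mul contMDiff_id).mul contMDiff_const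

lemma mdifferentiable_conj_right (g : G) :
    MDifferentiable 𝓘(ℝ, E) 𝓘(ℝ, E) (fun h : G => g * h * g⁻¹) :=
  (contMDiff_conj_right g).mdifferentiable (by simp)

lemma contMDiff_Ad : ContMDiff 𝓘(ℝ, E) 𝓘(ℝ, E →L[ℝ] E) ∞ (fun g : G => Ad E g) :=
  contMDiff_modelDeriv_of_fixed (1 : G) (fun g h => g * h * g⁻¹) contMDiff_conj (by simp)

lemma Ad_mul (g h : G) : Ad E (g * h) = Ad E g * Ad E h := by
  have h1 : (fun x : G => g * h * x * (g * h)⁻¹) =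
      (fun x : G => g * x * g⁻¹) ∘ (fun x : G => h * x * h⁻¹) := by
    ext; simp [mul_assoc]
  rw [Ad, h1, modelDeriv_comp (mdifferentiable_conj_right g _) (mdifferentiable_conj_right h _)]
  simp [Ad]

end Adjoint

/-! ### The derivative of Ad is the bracket -/

section Bracket

open Filter VectorField

variable {E : Type*} [NormedAddCommGroup E] [NormedSpace ℝ E]
  {G : Type*} [TopologicalSpace G] [ChartedSpace E G] [Group G] [LieGroup 𝓘(ℝ, E) ∞ G]

omit [Group G] [LieGroup 𝓘(ℝ, E) ∞ G] in
lemma contMDiffAt_chart_symm [IsManifold 𝓘(ℝ, E) ∞ G] (p : G) :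
    ContMDiffAt 𝓘(ℝ, E) 𝓘(ℝ, E) ∞ (extChartAt 𝓘(ℝ, E) p).symm (extChartAt 𝓘(ℝ, E) p p) :=
  (contMDiffOn_extChartAt_symm p).contMDiffAt (extChartAt_target_mem_nhds p)

/-- The Lie algebra bracket in the chart at the identity. -/
lemma bracket_eq_lieBracket (X Y : LieAlg E G) :
    ⁅X, Y⁆ = lieBracket ℝ
      (fun x => fderiv ℝ (fun y => extChartAt 𝓘(ℝ, E) (1 : G)
        ((extChartAt 𝓘(ℝ, E) (1 : G)).symm x * (extChartAt 𝓘(ℝ, E) (1 : G)).symm y))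
        (extChartAt 𝓘(ℝ, E) (1 : G) 1) X)
      (fun x => fderiv ℝ (fun y => extChartAt 𝓘(ℝ, E) (1 : G)
        ((extChartAt 𝓘(ℝ, E) (1 : G)).symm x * (extChartAt 𝓘(ℝ, E) (1 : G)).symm y))
        (extChartAt 𝓘(ℝ, E) (1 : G) 1) Y)
      (extChartAt 𝓘(ℝ, E) (1 : G) 1) := by
  set c := extChartAt 𝓘(ℝ, E) (1 : G) with hc
  set a := c 1 with ha
  -- Reads the left invariant fields in the chart, as partial derivatives of the local
  -- multiplication.
  have hfield : ∀ Z : LieAlg E G,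
      mpullbackWithin 𝓘(ℝ, E) 𝓘(ℝ, E) c.symm (mulInvariantVectorField Z)
        (Set.range 𝓘(ℝ, E)) =ᶠ[𝓝 a] fun x => fderiv ℝ (fun y => c (c.symm x * c.symm y)) a Z := by
    intro Z
    filter_upwards [extChartAt_target_mem_nhds (I := 𝓘(ℝ, E)) (1 : G)] with x hx
    have hinv : (mfderivWithin 𝓘(ℝ, E) 𝓘(ℝ, E) c.symm (Set.range 𝓘(ℝ, E)) x).inverse =
        mfderiv 𝓘(ℝ, E) 𝓘(ℝ, E) c (c.symm x) :=
      ContinuousLinearMap.inverse_eq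
        (mfderivWithin_extChartAt_symm_comp_mfderiv_extChartAt hx)
        (mfderiv_extChartAt_comp_mfderivWithin_extChartAt_symm hx)
    have hsrc : c.symm x ∈ (chartAt E (1 : G)).source := by
      rw [← extChartAt_source (I := 𝓘(ℝ, E))]
      exact c.map_target hx
    have hL : MDifferentiableAt 𝓘(ℝ, E) 𝓘(ℝ, E) (fun h : G => c.symm x * h) 1 :=
      (contMDiff_mul_left (I := 𝓘(ℝ, E)) (n := ∞)).mdifferentiable (by simp) _
    have hcd : MDifferentiableAt 𝓘(ℝ, E) 𝓘(ℝ, E) c (c.symm x * 1) := by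
      rw [mul_one]; exact mdifferentiableAt_extChartAt hsrc
    have hcomp := mfderiv_comp (I' := 𝓘(ℝ, E)) (1 : G) hcd hL
    rw [mpullbackWithin_apply, hinv, mulInvariantVectorField]
    have h1 : mfderiv 𝓘(ℝ, E) 𝓘(ℝ, E) (c ∘ fun h : G => c.symm x * h) 1 Z =
        fderiv ℝ (fun y => c (c.symm x * c.symm y)) a Z := by
      rw [(hcd.comp (1 : G) hL).mfderiv]
      simp only [writtenInExtChartAt, modelWithCornersSelf_coe, Set.range_id, fderivWithin_univ]
      rfl
    rw [← h1, hcomp]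
    have h2 : ∀ g, g = c.symm x → ∀ v : E, mfderiv 𝓘(ℝ, E) 𝓘(ℝ, E) c g v =
      mfderiv 𝓘(ℝ, E) 𝓘(ℝ, E) c (c.symm x) v := by rintro g rfl v; rfl
    exact (h2 _ (mul_one _) _).symm
  have hinv : ∀ L : E →L[ℝ] E, L = ContinuousLinearMap.id ℝ E → ∀ v, L.inverse v = v := by
    rintro L rfl v
    simp
  rw [GroupLieAlgebra.bracket_def, mlieBracket, mlieBracketWithin_apply]
  -- The chart has identity derivative at its base point, so the final pullback changes nothing.
  refine (hinv _ mfderiv_extChartAt_self _).trans ?_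
  have hset : c.symm ⁻¹' Set.univ ∩ Set.range 𝓘(ℝ, E) = Set.univ := by simp
  let V : LieAlg E G → E → E := fun Z =>
    mpullbackWithin 𝓘(ℝ, E) 𝓘(ℝ, E) c.symm (mulInvariantVectorField Z) (Set.range 𝓘(ℝ, E))
  change lieBracketWithin ℝ (V X) (V Y) (c.symm ⁻¹' Set.univ ∩ Set.range 𝓘(ℝ, E)) a = _
  rw [hset, lieBracketWithin_univ]
  exact (hfield X).lieBracket_vectorField_eq (hfield Y)

/-- The derivative at the identity of the adjoint representation is the Lie bracket. -/
theorem fderiv_Ad_chart_symm (X Y : LieAlg E G) :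
    DifferentiableAt ℝ (fun x => Ad E ((extChartAt 𝓘(ℝ, E) (1 : G)).symm x))
      (extChartAt 𝓘(ℝ, E) (1 : G) 1) ∧
    fderiv ℝ (fun x => Ad E ((extChartAt 𝓘(ℝ, E) (1 : G)).symm x))
      (extChartAt 𝓘(ℝ, E) (1 : G) 1) X Y = ⁅X, Y⁆ := by
  rw [bracket_eq_lieBracket]
  set c := extChartAt 𝓘(ℝ, E) (1 : G) with hc
  set a := c 1 with ha
  have hca : c.symm a = 1 := extChartAt_to_inv (I := 𝓘(ℝ, E)) (1 : G)
  have hsymm : ContMDiffAt 𝓘(ℝ, E) 𝓘(ℝ, E) ∞ c.symm a := contMDiffAt_chart_symm 1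
  have hchart : ContMDiffAt 𝓘(ℝ, E) 𝓘(ℝ, E) ∞ c 1 := contMDiffAt_extChartAt
  have htarget : ∀ᶠ x in 𝓝 a, x ∈ c.target := extChartAt_target_mem_nhds (1 : G)
  let m : E × E → E := fun p => c (c.symm p.1 * c.symm p.2)
  let k : E × E → E := fun p => c (c.symm p.1 * c.symm p.2 * (c.symm p.1)⁻¹)
  have hAd : (fun x => Ad E (c.symm x)) = fun x => fderiv ℝ (fun y => k (x, y)) a := by
    funext x
    rw [Ad, modelDeriv_eq_fderiv_chart (by simp) (mdifferentiable_conj_right _ _)]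
  have hAdd : DifferentiableAt ℝ (fun x => Ad E (c.symm x)) a := by
    have h : ContMDiffAt 𝓘(ℝ, E) 𝓘(ℝ, E →L[ℝ] E) ∞ (fun x => Ad E (c.symm x)) a :=
      (contMDiff_Ad (E := E) (G := G) (c.symm a)).comp a hsymm
    exact h.contDiffAt.differentiableAt (by simp)
  refine ⟨hAdd, ?_⟩
  have hs1 : ContMDiffAt 𝓘(ℝ, E × E) 𝓘(ℝ, E) ∞
      (fun p : E × E => c.symm p.1) (a, a) :=
    ContMDiffAt.comp (g := c.symm) (f := Prod.fst) (a, a) hsymm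
      contDiffAt_fst.contMDiffAt
  have hs2 : ContMDiffAt 𝓘(ℝ, E × E) 𝓘(ℝ, E) ∞
      (fun p : E × E => c.symm p.2) (a, a) :=
    ContMDiffAt.comp (g := c.symm) (f := Prod.snd) (a, a) hsymm
      contDiffAt_snd.contMDiffAt
  have hm : ContDiffAt ℝ 2 m (a, a) := by
    have h1 : ContMDiffAt 𝓘(ℝ, E × E) 𝓘(ℝ, E) ∞ m (a, a) :=
      ContMDiffAt.comp_of_eq (y := 1) hchart (hs1.mul hs2) (by simp [hca])
    exact (show ContDiffAt ℝ ∞ m (a, a) from h1.contDiffAt).of_le ENat.LEInfty.out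
  rw [hAd]
  refine fderiv_conj_apply_eq_lieBracket (m := m) (k := k) hm (Eventually.of_forall fun x => ?_)
    (hAd ▸ hAdd) ?_ ?_ (Eventually.of_forall fun x => by
      simp only [k, hca, mul_one, mul_inv_cancel]; rfl) ?_ ?_ X Y
  · have h1 : ContMDiffAt 𝓘(ℝ, E) 𝓘(ℝ, E) ∞ (fun y => k (x, y)) a :=
      ContMDiffAt.comp_of_eq (y := 1) hchart
        ((contMDiff_conj_right (c.symm x)).contMDiffAt.comp a hsymm) (by simp [hca])
    exact h1.contDiffAt.differentiableAt (by simp)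
  · filter_upwards [htarget] with x hx
    simp [m, hca, c.right_inv hx]
  · filter_upwards [htarget] with x hx
    simp [m, hca, c.right_inv hx]
  · filter_upwards [htarget] with x hx
    simp [k, hca, c.right_inv hx]
  -- The identity is gh = (ghg⁻¹)g, read where ghg⁻¹ stays in the chart domain.
  · have hcont : ContinuousAt (fun p : E × E => c.symm p.1 * c.symm p.2 * (c.symm p.1)⁻¹) (a, a) :=
      ((hs1.mul hs2).mul hs1.inv).continuousAt
    have hsrc : c.source ∈ 𝓝 (c.symm a * c.symm a * (c.symm a)⁻¹) := by
      rw [hca, inv_one, mul_one, mul_one]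
      exact extChartAt_source_mem_nhds (1 : G)
    filter_upwards [hcont.preimage_mem_nhds hsrc] with p hp
    simp only [m, k]
    rw [c.left_inv hp]
    simp

end Bracket

/-! ### From Ad-invariance to ad-invariance -/

section InvariantForm

variable {E : Type*} [NormedAddCommGroup E] [NormedSpace ℝ E] [FiniteDimensional ℝ E]
  {G : Type*} [TopologicalSpace G] [ChartedSpace E G] [Group G] [LieGroup 𝓘(ℝ, E) ∞ G]

/-- A bilinear form invariant under the adjoint representation is invariant under the Lie
algebra. -/
theorem invariant_of_Ad_invariant (B : E →ₗ[ℝ] E →ₗ[ℝ] ℝ)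
    (hB : ∀ (g : G) x y, B (Ad E g x) (Ad E g y) = B x y) (X Y Z : LieAlg E G) :
    B (show LieAlg E G from ⁅X, Y⁆) Z + B Y (show LieAlg E G from ⁅X, Z⁆) = 0 := by
  let br : LieAlg E G → LieAlg E G → LieAlg E G := fun X Y => ⁅X, Y⁆
  let lie : E → E → E := br
  have main : ∀ x y z : E, B (lie x y) z + B y (lie x z) = 0 := by
    intro x y z
    set c := extChartAt 𝓘(ℝ, E) (1 : G) with hc
    set a := c 1 with ha
    have hca : c.symm a = 1 := extChartAt_to_inv (I := 𝓘(ℝ, E)) (1 : G)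
    have hline : HasDerivAt (fun t : ℝ => a + t • x) x 0 := by
      simpa using ((hasDerivAt_id (0 : ℝ)).smul_const x).const_add a
    have hcurve : ∀ w : E, HasDerivAt (fun t : ℝ => Ad E (c.symm (a + t • x)) w) (lie x w) 0 := by
      intro w
      obtain ⟨hd, hbr⟩ := fderiv_Ad_chart_symm (E := E) (G := G) x w
      have hbr' : fderiv ℝ (fun x => Ad E (c.symm x)) a x w = lie x w := hbr
      rw [← hbr']
      have h1 := HasFDerivAt.comp_hasDerivAt_of_eq (0 : ℝ) hd.hasFDerivAt hline (by simp [ha, hc])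
      exact (h1.clm_apply (hasDerivAt_const (0 : ℝ) w)).congr_deriv (by
        rw [map_zero, add_zero])
    -- The form is constant along the curve, so its derivative at 0 vanishes.
    have hderiv := hasDerivAt_bilinear B (hcurve y) (hcurve z)
    simp only [hB, zero_smul, add_zero, hca, Ad_one] at hderiv
    exact (hderiv.unique (hasDerivAt_const (0 : ℝ) _))
  exact main X Y Z

end InvariantForm

/-! ### The differential of the flow and its generator -/

section Differential

open VectorField

variable {E : Type*} [NormedAddCommGroup E] [NormedSpace ℝ E]
  {G : Type*} [TopologicalSpace G] [ChartedSpace E G] [Group G]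

namespace Flow

lemma mdifferentiable_apply (φ : Flow E G) (t : ℝ) :
    MDifferentiable 𝓘(ℝ, E) 𝓘(ℝ, E) (fun g : G => φ t g) :=
  (φ.contMDiff_apply t).mdifferentiable (by simp)

/-- The differential of a flow of automorphisms at the identity, as an operator on the model
space. -/
def diff (φ : Flow E G) (t : ℝ) : E →L[ℝ] E := modelDeriv (fun g : G => φ t g) 1

lemma modelDeriv_neg_mul (φ : Flow E G) (t : ℝ) (g : G) :
    modelDeriv (E := E) (fun g : G => φ (-t) g) (φ t g) *
      modelDeriv (E := E) (fun g : G => φ t g) g = 1 := by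
  rw [← modelDeriv_comp (φ.mdifferentiable_apply _ _) (φ.mdifferentiable_apply _ _)]
  convert! modelDeriv_id (E := E) g
  ext h
  simp [← φ.apply_add, φ.apply_zero]

lemma modelDeriv_mul_neg (φ : Flow E G) (t : ℝ) (g : G) :
    modelDeriv (E := E) (fun g : G => φ t g) g *
      modelDeriv (E := E) (fun g : G => φ (-t) g) (φ t g) = 1 := by
  have h := φ.modelDeriv_neg_mul (-t) (φ t g)
  simpa [← φ.apply_add, φ.apply_zero] using h

lemma diff_zero (φ : Flow E G) : φ.diff 0 = 1 := by
  have : (fun g : G => φ 0 g) = id := funext φ.apply_zero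
  rw [diff, this, modelDeriv_id]

lemma diff_add (φ : Flow E G) (s t : ℝ) : φ.diff (s + t) = φ.diff s * φ.diff t := by
  have h1 : (fun g : G => φ (s + t) g) = (fun g : G => φ s g) ∘ fun g : G => φ t g :=
    funext (φ.apply_add s t)
  rw [diff, h1, modelDeriv_comp (φ.mdifferentiable_apply _ _) (φ.mdifferentiable_apply _ _)]
  simp [diff]

variable [LieGroup 𝓘(ℝ, E) ∞ G]

lemma differentiable_diff (φ : Flow E G) : Differentiable ℝ φ.diff := by
  have h : ContMDiff 𝓘(ℝ, ℝ) 𝓘(ℝ, E →L[ℝ] E) ∞ φ.diff :=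
    contMDiff_modelDeriv_of_fixed (1 : G) (fun t g => φ t g) φ.smooth' (by simp)
  exact h.contDiff.differentiable (by simp)

/-- Differentiate φ_t ∘ L_h = L_{φ_t(h)} ∘ φ_t at the identity, then invert the differential of φ_t
at h. -/
lemma mpullback_mulInvariantVectorField_diff (φ : Flow E G) (t : ℝ) (v : LieAlg E G) :
    mpullback 𝓘(ℝ, E) 𝓘(ℝ, E) (fun g : G => φ t g)
      (mulInvariantVectorField (φ.diffAtOne t v)) = mulInvariantVectorField v := by
  funext h
  have hL : ∀ g : G, MDifferentiable 𝓘(ℝ, E) 𝓘(ℝ, E) (fun x : G => g * x) := fun g =>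
    (contMDiff_mul_left (I := 𝓘(ℝ, E)) (n := ∞)).mdifferentiable (by simp)
  have h1 : (fun x : G => φ t h * x) ∘ (fun g : G => φ t g) =
      (fun g : G => φ t g) ∘ fun x : G => h * x := by
    ext x; simp
  have h2 := congrArg (modelDeriv (E := E) · 1) h1
  beta_reduce at h2
  rw [modelDeriv_comp (hL _ _) (φ.mdifferentiable_apply t _),
    modelDeriv_comp (φ.mdifferentiable_apply t _) (hL _ _), map_one, mul_one] at h2
  have h3 := DFunLike.congr_fun h2 v
  have hinv : ∀ L M : E →L[ℝ] E, M * L = 1 → L * M = 1 → ∀ w, L.inverse (L w) = w := by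
    intro L M hML hLM w
    rw [ContinuousLinearMap.inverse_eq hLM hML]
    exact DFunLike.congr_fun hML w
  have h4 := hinv _ _ (φ.modelDeriv_neg_mul t h) (φ.modelDeriv_mul_neg t h)
    (modelDeriv (fun x : G => h * x) 1 v)
  refine Eq.trans ?_ h4
  exact congrArg (modelDeriv (E := E) (fun g : G => φ t g) h).inverse h3

/-- Differentiating the invariance of a bilinear map under a flow. -/
lemma bilinear_generator [FiniteDimensional ℝ E] {F : Type*} [NormedAddCommGroup F] [NormedSpace ℝ F]
    (φ : Flow E G) (B : E →ₗ[ℝ] E →ₗ[ℝ] F) {Λ : ℝ → F} {Λ' : F} (hΛ : HasDerivAt Λ Λ' 0)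
    {x y : E} (h : ∀ t, B (φ.diff t x) (φ.diff t y) = Λ t) :
    B (deriv φ.diff 0 x) y + B x (deriv φ.diff 0 y) = Λ' := by
  have hcurve : ∀ v, HasDerivAt (fun t => φ.diff t v) (deriv φ.diff 0 v) 0 := fun v => by
    have h1 := (φ.differentiable_diff 0).hasDerivAt.clm_apply (hasDerivAt_const (0 : ℝ) v)
    exact h1.congr_deriv (by rw [map_zero, add_zero])
  have h1 := hasDerivAt_bilinear B (hcurve x) (hcurve y)
  simp only [h, φ.diff_zero] at h1
  exact h1.unique hΛ

variable [CompleteSpace E]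

/-- The differential of an automorphism of a Lie group is an automorphism of its Lie algebra. -/
lemma diffAtOne_lie (φ : Flow E G) (t : ℝ) (X Y : LieAlg E G) :
    φ.diffAtOne t ⁅X, Y⁆ = ⁅φ.diffAtOne t X, φ.diffAtOne t Y⁆ := by
  have h := mpullback_mlieBracket (I := 𝓘(ℝ, E)) (I' := 𝓘(ℝ, E)) (n := ∞) (x₀ := (1 : G))
    (f := fun g : G => φ t g)
    (V := mulInvariantVectorField (φ.diffAtOne t X))
    (W := mulInvariantVectorField (φ.diffAtOne t Y))
    (mdifferentiableAt_mulInvariantVectorField _) (mdifferentiableAt_mulInvariantVectorField _)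
    (φ.contMDiff_apply t 1) (by simpa using ENat.LEInfty.out)
  rw [φ.mpullback_mulInvariantVectorField_diff, φ.mpullback_mulInvariantVectorField_diff] at h
  rw [GroupLieAlgebra.bracket_def X Y, ← h]
  have hinv : ∀ L M : E →L[ℝ] E, M * L = 1 → L * M = 1 → ∀ w, L (L.inverse w) = w := by
    intro L M hML hLM w
    rw [ContinuousLinearMap.inverse_eq hLM hML]
    exact DFunLike.congr_fun hLM w
  refine (hinv _ _ (φ.modelDeriv_neg_mul t 1) (φ.modelDeriv_mul_neg t 1) _).trans ?_
  have hpt : ∀ g : G, g = 1 → (mlieBracket 𝓘(ℝ, E) (mulInvariantVectorField (φ.diffAtOne t X))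
      (mulInvariantVectorField (φ.diffAtOne t Y)) g : E) =
      (⁅φ.diffAtOne t X, φ.diffAtOne t Y⁆ : LieAlg E G) := by
    rintro g rfl; rfl
  exact hpt _ (map_one _)

/-- The automorphism of the Lie algebra given by the differential of `φ_t`. -/
def lieEquiv (φ : Flow E G) (t : ℝ) : LieAlg E G ≃ₗ⁅ℝ⁆ LieAlg E G where
  toLinearMap := (φ.diffAtOne t : LieAlg E G →ₗ[ℝ] LieAlg E G)
  map_lie' := φ.diffAtOne_lie t _ _
  invFun := φ.diffAtOne (-t)
  left_inv v := by
    have h := DFunLike.congr_fun (φ.diff_add (-t) t) v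
    rw [neg_add_cancel, φ.diff_zero] at h
    exact h.symm
  right_inv v := by
    have h := DFunLike.congr_fun (φ.diff_add t (-t)) v
    rw [add_neg_cancel, φ.diff_zero] at h
    exact h.symm

lemma killingForm_diffAtOne (φ : Flow E G) (t : ℝ) (X Y : LieAlg E G) :
    killingForm ℝ (LieAlg E G) (φ.diffAtOne t X) (φ.diffAtOne t Y) =
      killingForm ℝ (LieAlg E G) X Y :=
  LieAlgebra.killingForm_of_equiv_apply (φ.lieEquiv t) X Y

variable [FiniteDimensional ℝ E]

/-- The derivation generating the differential of a flow of automorphisms. -/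
def derivation (φ : Flow E G) : LieDerivation ℝ (LieAlg E G) (LieAlg E G) where
  toLinearMap := (deriv φ.diff 0).toLinearMap
  leibniz' X Y := by
    let br : LieAlg E G →ₗ[ℝ] LieAlg E G →ₗ[ℝ] LieAlg E G :=
      LinearMap.mk₂ ℝ (fun X Y => ⁅X, Y⁆) add_lie smul_lie lie_add lie_smul
    let B : E →ₗ[ℝ] E →ₗ[ℝ] E := br
    have hd : HasDerivAt (fun t => φ.diff t (B X Y)) (deriv φ.diff 0 (B X Y)) 0 := by
      have h1 := (φ.differentiable_diff 0).hasDerivAt.clm_apply (hasDerivAt_const (0 : ℝ) (B X Y))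
      exact h1.congr_deriv (by rw [map_zero, add_zero])
    have h := φ.bilinear_generator B hd (x := X) (y := Y)
      (fun t => (φ.diffAtOne_lie t X Y).symm)
    -- `LieDerivation` states the Leibniz rule as ⁅X, DY⁆ - ⁅Y, DX⁆.
    have h2 : ∀ a b : LieAlg E G, ∀ c d : LieAlg E G, ⁅a, d⁆ + ⁅c, b⁆ = ⁅c, b⁆ - ⁅d, a⁆ := by
      intro a b c d
      rw [← lie_skew a d]; abel
    exact h.symm.trans (h2 _ _ X Y)

lemma hasDerivation_derivation (φ : Flow E G) : φ.HasDerivation φ.derivation := by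
  intro t
  have h := eq_exp_of_oneParameterGroup φ.diff_zero φ.diff_add
    (φ.differentiable_diff 0).hasDerivAt t
  exact h

/-- The derivative at t = 0 of the invariance of the Killing form; this skewness yields ellipticity.
-/
lemma killingForm_derivation (φ : Flow E G) (X Y : LieAlg E G) :
    killingForm ℝ (LieAlg E G) (φ.derivation X) Y +
      killingForm ℝ (LieAlg E G) X (φ.derivation Y) = 0 := by
  let B : E →ₗ[ℝ] E →ₗ[ℝ] ℝ := killingForm ℝ (LieAlg E G)
  exact φ.bilinear_generator B (hasDerivAt_const (0 : ℝ) (B X Y))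
    (fun t => φ.killingForm_diffAtOne t X Y)

end Flow

end Differential

/-! ### Negative definiteness of the Killing form -/

section Compact

variable {E : Type*} [NormedAddCommGroup E] [NormedSpace ℝ E] [FiniteDimensional ℝ E]
  [CompleteSpace E]
  {G : Type*} [TopologicalSpace G] [ChartedSpace E G] [Group G] [LieGroup 𝓘(ℝ, E) ∞ G]

/-- The Killing form of a compact semisimple Lie group is negative definite. -/
theorem killingForm_neg_of_compact [CompactSpace G] [LieAlgebra.IsSemisimple ℝ (LieAlg E G)]
    (X : LieAlg E G) (hX : X ≠ 0) : killingForm ℝ (LieAlg E G) X X < 0 := by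
  have : IsTopologicalGroup G := topologicalGroup_of_lieGroup 𝓘(ℝ, E) ∞
  have : FiniteDimensional ℝ (LieAlg E G) := inferInstanceAs (FiniteDimensional ℝ E)
  obtain ⟨B, hsymm, hpos, hinv⟩ := exists_invariant_posDef (fun g : G => Ad E g)
    contMDiff_Ad.continuous Ad_one Ad_mul
  -- Semisimplicity enters here, through the vanishing of the center.
  exact killingForm_neg_of_invariant (by simp) (L := LieAlg E G) B hsymm hpos
    (invariant_of_Ad_invariant B hinv) X hX

end Compact

end AutomorphismFlow

end

theorem proposition4p3 {E : Type*} [NormedAddCommGroup E] [NormedSpace ℝ E]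
    [FiniteDimensional ℝ E] [CompleteSpace E]
    {G : Type*} [TopologicalSpace G] [ChartedSpace E G] [Group G] [LieGroup 𝓘(ℝ, E) ∞ G]
    [CompactSpace G] [ConnectedSpace G]
    [LieAlgebra.IsSemisimple ℝ (AutomorphismFlow.LieAlg E G)]
    (φ : AutomorphismFlow.Flow E G) :
    -- the negative Killing form is positive definite, and invariant under the flow
    (∀ X : AutomorphismFlow.LieAlg E G, X ≠ 0 →
      0 < -(killingForm ℝ (AutomorphismFlow.LieAlg E G) X X)) ∧
    (∀ (t : ℝ) (X Y : AutomorphismFlow.LieAlg E G),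
      killingForm ℝ (AutomorphismFlow.LieAlg E G) (φ.diffAtOne t X) (φ.diffAtOne t Y) =
        killingForm ℝ (AutomorphismFlow.LieAlg E G) X Y) ∧
    φ.IsElliptic ∧ φ.IsChainTransitive := by
  have hneg : ∀ X : AutomorphismFlow.LieAlg E G, X ≠ 0 →
      0 < -(killingForm ℝ (AutomorphismFlow.LieAlg E G) X X) := fun X hX =>
    neg_pos.2 (AutomorphismFlow.killingForm_neg_of_compact X hX)
  have : IsTopologicalGroup G := topologicalGroup_of_lieGroup 𝓘(ℝ, E) ∞
  have : FiniteDimensional ℝ (AutomorphismFlow.LieAlg E G) :=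
    inferInstanceAs (FiniteDimensional ℝ E)
  refine ⟨hneg, φ.killingForm_diffAtOne, ⟨φ.derivation, φ.hasDerivation_derivation, ?_⟩,
    φ.isChainTransitive_of_compact⟩
  refine AutomorphismFlow.isEllipticEnd_of_skew
    (-(killingForm ℝ (AutomorphismFlow.LieAlg E G))) (fun X Y => ?_) hneg _ (fun X Y => ?_)
  · exact congrArg Neg.neg (LieModule.traceForm_comm ℝ _ _ X Y)
  · have h := φ.killingForm_derivation X Y
    simp only [LinearMap.neg_apply]
    exact (neg_add _ _).symm.trans (neg_eq_zero.2 h)
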